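/- Theorem 4. There is a deterministic dynamic algorithm for submonoid membership in commutative monoids with constant parallel update and query time and polynomially many processors (a deterministic $\mathrm{DynAC}^0$ algorithm). Precisely, there are constants $c, T\in\mathbb{N}$ and four fixed programs (initialize, insert, delete, query) for a deterministic synchronous CRCW PRAM such that the following holds for every $n$, every commutative monoid $M$ with $n$ elements numbered $0,\dots,n-1$, and every $S\subseteq M$. On size parameter $n$ the machine has $(n+2)^c$ processors, all executing the same program. Its words are integers modulo $(n+2)^c$, so they have $O(\log n)$ bits and address polynomially many shared memory cells. It has unit-cost word arithmetic $(+,\dot{-},\times,\div,\bmod)$, comparison, jumps and shared-memory access, and the processor of least index wins a write conflict. Given the multiplication table of $M$ and the characteristic vector of $S$ in shared memory, the initialization program halts within $T\cdot(\lfloor\log_2 n\rfloor+1)$ steps. After that, for every finite sequence of requests, each of the form "insert $a$ into $S$", "delete $a$ from $S$" or "query $m$" with $a,m\in M$, the corresponding programs, run one after the other on the shared memory left by the previous one, each halt within $T$ steps, and each query $m$ is answered by $1$ if $m\in\langle S\rangle$ and by $0$ otherwise, where $\langle S\rangle$ is the submonoid generated by the set $S$ current at that time. -/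

import Mathlib

/-! ### Concurrent-read concurrent-write parallel random access machines -/

namespace PRAM

/-- Arithmetic operations on machine words (`sub` is truncated at zero). -/
inductive BinOp
  | add | sub | mul | div | mod

def BinOp.eval : BinOp → ℕ → ℕ → ℕ
  | .add, x, y => x + y
  | .sub, x, y => x - y
  | .mul, x, y => x * y
  | .div, x, y => x / y
  | .mod, x, y => x % y

/-- Instructions of a processor.  `R` denotes its private registers, `Mem` the shared memory. -/
inductive Instr
  /-- `R[d] := k` -/
  | const (d k : ℕ)
  /-- `R[d] := n`, the size parameter of the input -/
  | size (d : ℕ)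
  /-- `R[d] :=` the index of the processor -/
  | pid (d : ℕ)
  /-- `R[d] := f (R[a], R[b])` -/
  | op (f : BinOp) (d a b : ℕ)
  /-- `R[d] := Mem[R[a]]` -/
  | load (d a : ℕ)
  /-- `Mem[R[a]] := R[v]` -/
  | store (a v : ℕ)
  /-- if `R[a] < R[b]` then continue at instruction number `t` -/
  | jlt (a b t : ℕ)

/-- One program, executed by all processors and for all input sizes.  A processor whose program
counter points beyond the end of the program has halted. -/
abbrev Program := List Instr

/-- The private state of a processor. -/
structure Proc where
  pc : ℕ
  reg : ℕ → ℕ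

/-- A configuration: the shared memory and the states of the processors. -/
structure Config where
  mem : ℕ → ℕ
  proc : ℕ → Proc

/-- For the exponent `c` and size parameter `n`, there are `(n + 2) ^ c` processors, and
every word computed is reduced modulo `(n + 2) ^ c`.  So words have `O(log n)` bits, and only
polynomially many memory cells can be addressed. -/
def bound (c n : ℕ) : ℕ := (n + 2) ^ c

/-- Write the word `v` (truncated to the word size) to register `d` and go to the next
instruction. -/
def Proc.set (c n : ℕ) (s : Proc) (d v : ℕ) : Proc :=
  ⟨s.pc + 1, Function.update s.reg d (v % bound c n)⟩

/-- The new private state of processor `i` after one step, where `mem` is the shared memory before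
the step. -/
def Proc.step (c n : ℕ) (prog : Program) (mem : ℕ → ℕ) (i : ℕ) (s : Proc) : Proc :=
  match prog[s.pc]? with
  | none => s
  | some (.const d k) => s.set c n d k
  | some (.size d) => s.set c n d n
  | some (.pid d) => s.set c n d i
  | some (.op f d a b) => s.set c n d (f.eval (s.reg a) (s.reg b))
  | some (.load d a) => s.set c n d (mem (s.reg a))
  | some (.store _ _) => ⟨s.pc + 1, s.reg⟩
  | some (.jlt a b t) => ⟨if s.reg a < s.reg b then t else s.pc + 1, s.reg⟩

/-- The value that a processor in state `s` attempts to write to the memory cell `x` in the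
current step, if any. -/
def Proc.writes (prog : Program) (x : ℕ) (s : Proc) : Option ℕ :=
  match prog[s.pc]? with
  | some (.store a v) => if s.reg a = x then some (s.reg v) else none
  | _ => none

/-- One synchronous step of all processors.  All reads precede all writes.  If several processors
write to the same cell, the one with the least index succeeds. -/
def Config.step (c n : ℕ) (prog : Program) (C : Config) : Config where
  mem x := ((List.range (bound c n)).findSome? fun i => (C.proc i).writes prog x).getD (C.mem x)
  proc i := (C.proc i).step c n prog C.mem i

/-- The start configuration on shared memory `mem`. -/
def start (mem : ℕ → ℕ) : Config where
  mem := mem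
  proc _ := ⟨0, fun _ => 0⟩

/-- The configuration after `t` steps, started on shared memory `mem`. -/
def run (c n : ℕ) (prog : Program) (t : ℕ) (mem : ℕ → ℕ) : Config :=
  (Config.step c n prog)^[t] (start mem)

/-- All processors halt within `t` steps, when started on shared memory `mem`, and then the shared
memory is `mem'`. -/
def HaltsWithin (c n : ℕ) (prog : Program) (t : ℕ) (mem mem' : ℕ → ℕ) : Prop :=
  (∀ i < bound c n, prog.length ≤ ((run c n prog t mem).proc i).pc) ∧
    (run c n prog t mem).mem = mem'

end PRAM

/-! ### The dynamic membership problem for commutative monoids -/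

namespace DynMembership

open PRAM

/-- The memory cell in which the argument of a request is passed. -/
def argCell : ℕ := 0

/-- The memory cell in which the answer to a query is returned. -/
def answerCell : ℕ := 1

open Classical in
/-- The initial shared memory: the elements of `M` are numbered through `e`.  From cell `2` on it
holds the `n * n` entries of the multiplication table, row by row, followed by the `n` bits of the
characteristic vector of the initial generating set `S`.  All other cells are `0`. -/
noncomputable def inputMemory {M : Type*} [CommMonoid M] {n : ℕ} (e : M ≃ Fin n) (S : Set M)
    (x : ℕ) : ℕ :=
  if x < 2 then 0
  else if h : x - 2 < n * n then
    e (e.symm (finProdFinEquiv.symm ⟨x - 2, h⟩).1 * e.symm (finProdFinEquiv.symm ⟨x - 2, h⟩).2)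
  else if h : x - 2 - n * n < n then
    if e.symm ⟨x - 2 - n * n, h⟩ ∈ S then 1 else 0
  else 0

/-- A request: a single insertion into, a single deletion from, or a membership query to the
submonoid generated by, the current set. -/
inductive Request (M : Type*)
  | insert (a : M)
  | delete (a : M)
  | query (m : M)

/-- Started with shared memory `mem` and current generating set `S`, the programs `ins`, `del` and
`qry` process every request of the list, one after the other, each in at most `T` steps, and all
queries are answered correctly with respect to the generating set current at that time.  The shared
memory is kept from one request to the next. -/
def Serves (c T : ℕ) (ins del qry : Program) {M : Type*} [CommMonoid M] {n : ℕ} (e : M ≃ Fin n) :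
    (ℕ → ℕ) → Set M → List (Request M) → Prop
  | _, _, [] => True
  | mem, S, .insert a :: rs => ∃ mem' : ℕ → ℕ,
      HaltsWithin c n ins T (Function.update mem argCell (e a)) mem' ∧
        Serves c T ins del qry e mem' (S ∪ {a}) rs
  | mem, S, .delete a :: rs => ∃ mem' : ℕ → ℕ,
      HaltsWithin c n del T (Function.update mem argCell (e a)) mem' ∧
        Serves c T ins del qry e mem' (S \ {a}) rs
  | mem, S, .query m :: rs => ∃ mem' : ℕ → ℕ,
      HaltsWithin c n qry T (Function.update mem argCell (e m)) mem' ∧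
        (m ∈ Submonoid.closure S → mem' answerCell = 1) ∧
        (m ∉ Submonoid.closure S → mem' answerCell = 0) ∧
        Serves c T ins del qry e mem' S rs

end DynMembership

/-! Number the elements of `M` and keep, for every pair of indices `i, j`, the characteristic vector
of the submonoid generated by those elements of `S` whose number lies in `[i, j)`. In a commutative
monoid the submonoid generated by `A ∪ B` is the set of products of an element of `⟨A⟩` and an
element of `⟨B⟩` (`mem_closure_union`). Hence each update is a single product of two sets that are
already stored. A query reads the entry for `[0, n)`. Inserting `a` multiplies each entry whose
interval contains `a` by `⟨a⟩`. The sets `⟨a⟩` do not depend on `S` and are kept in an extra row `n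
+ 1`. Deleting `a` replaces such an entry by the product of the entries for `[i, a)` and `[a + 1,
j)`, neither of which is affected by the deletion. This is where all intervals, and not only `[0,
n)`, are needed. A product of sets takes constant time with one processor for each quadruple `(i, j,
u, v)`: if `u` and `v` lie in the two factors, it writes `1` at `u * v` in the vector of `(i, j)`.
The four base-`(n + 2)` digits of the processor index give the quadruple, which is why the exponent
is 4. Processors that compete for a cell always write the same value, so the priority rule plays no
role. Initially the vectors of `{1} ∪ gens e S i j` are squared repeatedly. By pigeonhole on prefix
products, every element of a generated submonoid is a product of fewer than `n` generators
(`exists_short_list`), so `⌊log₂ n⌋ + 1` squarings suffice. On the machine level all processors run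
in lockstep: request programs are straight-line code, so their length bounds their running time for
every `n`, and the only jump, in the initialization loop, tests values common to all processors. -/

namespace PRAM

section Execution

variable {c n : ℕ} {prog : Program}

/-! ### Synchronous execution of expressions and parallel stores -/

/-- The instructions `code` occur in `prog` from position `p` on. -/
def CodeAt (prog code : Program) (p : ℕ) : Prop :=
  ∀ k < code.length, prog[p + k]? = code[k]?

theorem CodeAt.left {a b : Program} {p : ℕ} (h : CodeAt prog (a ++ b) p) : CodeAt prog a p := by
  intro k hk
  rw [h k (by simp; omega), List.getElem?_append_left hk]

theorem CodeAt.right {a b : Program} {p : ℕ} (h : CodeAt prog (a ++ b) p) :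
    CodeAt prog b (p + a.length) := by
  intro k hk
  rw [Nat.add_assoc, h (a.length + k) (by simp; omega),
    List.getElem?_append_right (by omega), Nat.add_sub_cancel_left]

theorem CodeAt.head {a : Instr} {p : ℕ} (h : CodeAt prog [a] p) : prog[p]? = some a := by
  simpa using h 0 (by simp)

theorem codeAt_self (prog : Program) : CodeAt prog prog 0 := by
  intro k _
  simp

/-- All processors are about to execute instruction `p`, on shared memory `mem`. -/
def Config.Sync (C : Config) (p : ℕ) (mem : ℕ → ℕ) : Prop :=
  C.mem = mem ∧ ∀ i, (C.proc i).pc = p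

theorem sync_start (mem : ℕ → ℕ) : (start mem).Sync 0 mem := ⟨rfl, fun _ => rfl⟩

theorem Config.step_mem_of_writes_none {C : Config}
    (h : ∀ i x, (C.proc i).writes prog x = none) : (C.step c n prog).mem = C.mem := by
  funext x
  have : ((List.range (bound c n)).findSome? fun i => (C.proc i).writes prog x) = none :=
    List.findSome?_eq_none_iff.2 fun i _ => h i x
  simp [Config.step, this]

theorem Config.Sync.step_of_length_le {C : Config} {p : ℕ} {mem : ℕ → ℕ} (h : C.Sync p mem)
    (hp : prog.length ≤ p) : (C.step c n prog).Sync p mem := by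
  have hn : prog[p]? = none := List.getElem?_eq_none hp
  refine ⟨?_, fun i => ?_⟩
  · rw [Config.step_mem_of_writes_none, h.1]
    intro i x
    simp [Proc.writes, h.2 i, hn]
  · simp [Config.step, Proc.step, h.2 i, hn]

theorem Config.Sync.iterate_of_length_le {C : Config} {p : ℕ} {mem : ℕ → ℕ} (h : C.Sync p mem)
    (hp : prog.length ≤ p) (t : ℕ) : ((Config.step c n prog)^[t] C).Sync p mem := by
  induction t with
  | zero => exact h
  | succ t ih => rw [Function.iterate_succ_apply']; exact ih.step_of_length_le hp

/-- A synchronous run that reaches the end of the program halts. -/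
theorem haltsWithin_of_sync {t t' p : ℕ} {mem mem' : ℕ → ℕ} (h : (run c n prog t mem).Sync p mem')
    (hp : prog.length ≤ p) (ht : t ≤ t') : HaltsWithin c n prog t' mem mem' := by
  have := h.iterate_of_length_le (c := c) (n := n) hp (t' - t)
  rw [run, ← Function.iterate_add_apply, Nat.sub_add_cancel ht] at this
  exact ⟨fun i _ => by rw [run, this.2 i]; exact hp, this.1⟩

/-- Expressions over the shared memory, the processor index and the size parameter. -/
inductive Expr
  | const (k : ℕ)
  | size
  | pid
  | op (f : BinOp) (a b : Expr)
  | load (a : Expr)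

/-- The value of an expression for processor `i`. -/
def Expr.eval (c n : ℕ) (mem : ℕ → ℕ) (i : ℕ) : Expr → ℕ
  | .const k => k % bound c n
  | .size => n % bound c n
  | .pid => i % bound c n
  | .op f a b => f.eval (a.eval c n mem i) (b.eval c n mem i) % bound c n
  | .load a => mem (a.eval c n mem i) % bound c n

/-- Code that computes an expression into register `d` and leaves the registers below `d`
unchanged. -/
def Expr.compile : Expr → ℕ → Program
  | .const k, d => [.const d k]
  | .size, d => [.size d]
  | .pid, d => [.pid d]
  | .op f a b, d => a.compile d ++ (b.compile (d + 1) ++ [.op f d d (d + 1)])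
  | .load a, d => a.compile d ++ [.load d d]

theorem Config.Sync.step_set {C : Config} {p d : ℕ} {mem : ℕ → ℕ} {f : ℕ → ℕ} (h : C.Sync p mem)
    (hw : ∀ i x, (C.proc i).writes prog x = none)
    (hs : ∀ i, (C.proc i).step c n prog mem i = (C.proc i).set c n d (f i)) :
    (C.step c n prog).Sync (p + 1) mem ∧
      ∀ i, ((C.step c n prog).proc i).reg d = f i % bound c n ∧
        ∀ r < d, ((C.step c n prog).proc i).reg r = (C.proc i).reg r := by
  have hs' : ∀ i, (C.step c n prog).proc i = (C.proc i).set c n d (f i) := by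
    intro i
    rw [← hs i, ← h.1]; rfl
  refine ⟨⟨by rw [Config.step_mem_of_writes_none hw, h.1], fun i => ?_⟩, fun i => ⟨?_, ?_⟩⟩
  · rw [hs', ← h.2 i]; rfl
  · rw [hs']; simp [Proc.set]
  · intro r hr
    rw [hs']
    simp [Proc.set, Function.update_of_ne hr.ne]

/-- Compiled expressions neither jump nor store, so lockstep and memory are preserved. The clause on
registers below `d` drives the induction: the first operand must survive in `d` while the second is
computed from `d + 1` on. -/
theorem Expr.sync_compile (e : Expr) : ∀ {C : Config} {p d : ℕ} {mem : ℕ → ℕ},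
    C.Sync p mem → CodeAt prog (e.compile d) p →
    ((Config.step c n prog)^[(e.compile d).length] C).Sync (p + (e.compile d).length) mem ∧
      ∀ i, (((Config.step c n prog)^[(e.compile d).length] C).proc i).reg d = e.eval c n mem i ∧
        ∀ r < d, (((Config.step c n prog)^[(e.compile d).length] C).proc i).reg r =
          (C.proc i).reg r := by
  induction e with
  | const k =>
    intro C p d mem h hc
    have := hc.head
    exact h.step_set (f := fun _ => k) (by simp [Proc.writes, h.2, this])
      (by simp [Proc.step, h.2, this])
  | size =>
    intro C p d mem h hc
    have := hc.head
    exact h.step_set (f := fun _ => n) (by simp [Proc.writes, h.2, this])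
      (by simp [Proc.step, h.2, this])
  | pid =>
    intro C p d mem h hc
    have := hc.head
    exact h.step_set (f := fun i => i) (by simp [Proc.writes, h.2, this])
      (by simp [Proc.step, h.2, this])
  | op f a b iha ihb =>
    intro C p d mem h hc
    obtain ⟨h1, hr1⟩ := iha h hc.left
    obtain ⟨h2, hr2⟩ := ihb h1 hc.right.left
    have hi := hc.right.right.head
    have key := h2.step_set (c := c) (n := n) (prog := prog) (d := d)
      (f := fun i => f.eval (a.eval c n mem i) (b.eval c n mem i))
      (by simp [Proc.writes, h2.2, hi])
      (by intro i
          simp only [Proc.step, h2.2, hi]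
          rw [(hr2 i).1, (hr2 i).2 d (Nat.lt_succ_self d), (hr1 i).1])
    rw [← Function.iterate_add_apply, ← Function.iterate_succ_apply' (Config.step c n prog)] at key
    have hl : ((Expr.op f a b).compile d).length =
        ((b.compile (d + 1)).length + (a.compile d).length).succ := by
      simp [Expr.compile]; omega
    rw [hl]
    refine ⟨?_, fun i => ⟨(key.2 i).1, fun r hr => ?_⟩⟩
    · convert key.1 using 1
      omega
    · rw [(key.2 i).2 r hr, Function.iterate_add_apply, (hr2 i).2 r (by omega), (hr1 i).2 r hr]
  | load a iha =>
    intro C p d mem h hc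
    obtain ⟨h1, hr1⟩ := iha h hc.left
    have hi := hc.right.head
    have key := h1.step_set (c := c) (n := n) (prog := prog) (d := d)
      (f := fun i => mem (a.eval c n mem i))
      (by simp [Proc.writes, h1.2, hi])
      (by intro i
          simp only [Proc.step, h1.2, hi]
          rw [(hr1 i).1])
    rw [← Function.iterate_succ_apply' (Config.step c n prog)] at key
    have hl : ((Expr.load a).compile d).length = (a.compile d).length.succ := by
      simp [Expr.compile]
    rw [hl]
    refine ⟨key.1, fun i => ⟨(key.2 i).1, fun r hr => ?_⟩⟩
    rw [(key.2 i).2 r hr, (hr1 i).2 r hr]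

/-- Code that stores the value of `v` to the cell with address `a`. -/
def storeCode (a v : Expr) : Program :=
  a.compile 0 ++ (v.compile 1 ++ [.store 0 1])

/-- The effect of `storeCode` on the shared memory. -/
def storeEffect (c n : ℕ) (a v : Expr) (mem : ℕ → ℕ) (x : ℕ) : ℕ :=
  ((List.range (bound c n)).findSome? fun i =>
    if a.eval c n mem i = x then some (v.eval c n mem i) else none).getD (mem x)

theorem sync_storeCode {a v : Expr} {C : Config} {p : ℕ} {mem : ℕ → ℕ}
    (h : C.Sync p mem) (hc : CodeAt prog (storeCode a v) p) :
    ((Config.step c n prog)^[(storeCode a v).length] C).Sync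
      (p + (storeCode a v).length) (storeEffect c n a v mem) := by
  obtain ⟨h1, hr1⟩ := a.sync_compile (c := c) (n := n) h hc.left
  obtain ⟨h2, hr2⟩ := v.sync_compile (c := c) (n := n) h1 hc.right.left
  have hi := hc.right.right.head
  have hl : (storeCode a v).length = ((v.compile 1).length + (a.compile 0).length).succ := by
    simp [storeCode]; omega
  rw [hl, Function.iterate_succ_apply', Function.iterate_add_apply]
  refine ⟨?_, fun i => ?_⟩
  · funext x
    simp only [Config.step, Proc.writes, h2.1, h2.2, hi, storeEffect]
    congr 2
    funext i
    rw [(hr2 i).1, (hr2 i).2 0 Nat.zero_lt_one, (hr1 i).1]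
  · simp only [Config.step, Proc.step, h2.2, hi]
    omega

/-- Code for a sequence of parallel stores, given as pairs of an address and a value -/
def storesCode (l : List (Expr × Expr)) : Program :=
  l.flatMap fun s => storeCode s.1 s.2

/-- The effect of `storesCode` on the shared memory. -/
def storesEffect (c n : ℕ) (l : List (Expr × Expr)) (mem : ℕ → ℕ) : ℕ → ℕ :=
  l.foldl (fun m s => storeEffect c n s.1 s.2 m) mem

theorem sync_storesCode (l : List (Expr × Expr)) : ∀ {C : Config} {p : ℕ} {mem : ℕ → ℕ},
    C.Sync p mem → CodeAt prog (storesCode l) p →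
    ((Config.step c n prog)^[(storesCode l).length] C).Sync
      (p + (storesCode l).length) (storesEffect c n l mem) := by
  induction l with
  | nil => intro C p mem h _; exact h
  | cons s l ih =>
    intro C p mem h hc
    have h2 := ih (sync_storeCode (c := c) (n := n) h hc.left) hc.right
    rw [← Function.iterate_add_apply] at h2
    have hl : (storesCode (s :: l)).length =
        (storesCode l).length + (storeCode s.1 s.2).length := by
      simp [storesCode, Nat.add_comm]
    rw [hl, Nat.add_comm (storesCode l).length, ← Nat.add_assoc,
      Nat.add_comm (storeCode s.1 s.2).length]
    exact h2

/-- Straight-line code runs for exactly as many steps as it has instructions, whatever `n` is. This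
is the source of the constant time bound for requests. -/
theorem haltsWithin_storesCode {l : List (Expr × Expr)} {mem : ℕ → ℕ} {t : ℕ}
    (ht : (storesCode l).length ≤ t) :
    HaltsWithin c n (storesCode l) t mem (storesEffect c n l mem) :=
  haltsWithin_of_sync (sync_storesCode l (sync_start mem) (codeAt_self _)) (by omega) ht

/-- If all processors store the same value, then exactly the addressed cells change. -/
theorem storeEffect_of_forall_eq {a v : Expr} {mem : ℕ → ℕ} {b : ℕ}
    (hv : ∀ i, v.eval c n mem i = b) (x : ℕ) [Decidable (∃ i < bound c n, a.eval c n mem i = x)] :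
    storeEffect c n a v mem x = if ∃ i < bound c n, a.eval c n mem i = x then b else mem x := by
  unfold storeEffect
  cases h : (List.range (bound c n)).findSome? fun i =>
      if a.eval c n mem i = x then some (v.eval c n mem i) else none with
  | none =>
    rw [List.findSome?_eq_none_iff] at h
    rw [if_neg]
    · rfl
    · rintro ⟨i, hi, hx⟩
      simpa [hx] using h i (List.mem_range.2 hi)
  | some y =>
    obtain ⟨i, hi, hy⟩ := List.exists_of_findSome?_eq_some h
    rw [hv] at hy
    split_ifs at hy with hx
    · rw [if_pos ⟨i, List.mem_range.1 hi, hx⟩]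
      simpa using hy.symm

/-- Code that jumps to `t` if the value of `a` is less than that of `b`. -/
def jumpCode (a b : Expr) (t : ℕ) : Program :=
  a.compile 0 ++ (b.compile 1 ++ [.jlt 0 1 t])

/-- Both compared values are required to be the same for all processors, so all of them take the
same branch and stay in lockstep. -/
theorem sync_jumpCode {a b : Expr} {t : ℕ} {C : Config} {p : ℕ} {mem : ℕ → ℕ} {x y : ℕ}
    (h : C.Sync p mem) (hc : CodeAt prog (jumpCode a b t) p)
    (ha : ∀ i, a.eval c n mem i = x) (hb : ∀ i, b.eval c n mem i = y) :
    ((Config.step c n prog)^[(jumpCode a b t).length] C).Sync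
      (if x < y then t else p + (jumpCode a b t).length) mem := by
  obtain ⟨h1, hr1⟩ := a.sync_compile (c := c) (n := n) h hc.left
  obtain ⟨h2, hr2⟩ := b.sync_compile (c := c) (n := n) h1 hc.right.left
  have hi := hc.right.right.head
  have hl : (jumpCode a b t).length = ((b.compile 1).length + (a.compile 0).length).succ := by
    simp [jumpCode]; omega
  rw [hl, Function.iterate_succ_apply', Function.iterate_add_apply]
  refine ⟨?_, fun i => ?_⟩
  · rw [Config.step_mem_of_writes_none, h2.1]
    intro i x
    simp [Proc.writes, h2.2, hi]
  · simp only [Config.step, Proc.step, h2.2, hi]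
    rw [(hr2 i).1, (hr2 i).2 0 Nat.zero_lt_one, (hr1 i).1, ha, hb]
    split_ifs
    · rfl
    · omega

end Execution

section Expressions

variable {n : ℕ} {mem : ℕ → ℕ} {p : ℕ}

/-! ### Arithmetic and Boolean expressions on machines with `(n + 2) ^ 4` processors -/

namespace Expr

theorem eval_lt (e : Expr) : e.eval 4 n mem p < bound 4 n := by
  have : 0 < bound 4 n := by unfold bound; positivity
  cases e <;> exact Nat.mod_lt _ this

/-- The value of `e` for processor `p` is the truth value of `P`. -/
def Decides (n : ℕ) (mem : ℕ → ℕ) (p : ℕ) (e : Expr) (P : Prop) : Prop :=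
  (P → e.eval 4 n mem p = 1) ∧ (¬P → e.eval 4 n mem p = 0)

theorem Decides.congr {e : Expr} {P Q : Prop} (h : Decides n mem p e P) (hPQ : P ↔ Q) :
    Decides n mem p e Q := by
  rwa [Decides, ← hPQ]

theorem one_lt_bound : 1 < bound 4 n := Nat.one_lt_pow (by norm_num) (by omega)

/-- `a ≤ b` -/
def le (a b : Expr) : Expr := op .sub (const 1) (op .sub a b)

theorem decides_le (a b : Expr) :
    Decides n mem p (le a b) (a.eval 4 n mem p ≤ b.eval 4 n mem p) := by
  have h1 := one_lt_bound (n := n)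
  have ha : a.eval 4 n mem p < bound 4 n := a.eval_lt
  have h : (le a b).eval 4 n mem p = 1 - (a.eval 4 n mem p - b.eval 4 n mem p) := by
    simp only [le, eval, BinOp.eval]
    rw [Nat.mod_eq_of_lt h1, Nat.mod_eq_of_lt (a := _ - _) (by omega),
      Nat.mod_eq_of_lt (by omega)]
  exact ⟨fun _ => by omega, fun _ => by omega⟩

/-- Negation of a truth value -/
def not (a : Expr) : Expr := op .sub (const 1) a

theorem Decides.not {a : Expr} {P : Prop} (h : Decides n mem p a P) :
    Decides n mem p a.not (¬P) := by
  have h1 := one_lt_bound (n := n)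
  have h' : a.not.eval 4 n mem p = 1 - a.eval 4 n mem p := by
    simp only [Expr.not, eval, BinOp.eval]
    rw [Nat.mod_eq_of_lt h1, Nat.mod_eq_of_lt (by omega)]
  refine ⟨fun hP => ?_, fun hP => ?_⟩
  · rw [h', h.2 hP]
  · rw [h', h.1 (not_not.1 hP)]

/-- Conjunction of truth values -/
def and (a b : Expr) : Expr := op .mul a b

/-- The second test has to be correct only under `P`, since a factor `0` masks any value. This
allows range checks to protect table look-ups whose address would otherwise be meaningless. -/
theorem Decides.and {a b : Expr} {P Q : Prop} (ha : Decides n mem p a P)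
    (hb : P → Decides n mem p b Q) : Decides n mem p (a.and b) (P ∧ Q) := by
  have h' : (a.and b).eval 4 n mem p = a.eval 4 n mem p * b.eval 4 n mem p % bound 4 n := rfl
  refine ⟨fun h => ?_, fun h => ?_⟩
  · rw [h', ha.1 h.1, (hb h.1).1 h.2, Nat.mod_eq_of_lt one_lt_bound]
  · by_cases hP : P
    · rw [h', (hb hP).2 fun hQ => h ⟨hP, hQ⟩]
      simp
    · rw [h', ha.2 hP]
      simp

/-- `a < b` -/
def lt (a b : Expr) : Expr := (le b a).not

theorem decides_lt (a b : Expr) :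
    Decides n mem p (lt a b) (a.eval 4 n mem p < b.eval 4 n mem p) :=
  (decides_le b a).not.congr not_le

/-- `a = b` -/
def eq (a b : Expr) : Expr := (le a b).and (le b a)

theorem decides_eq (a b : Expr) :
    Decides n mem p (eq a b) (a.eval 4 n mem p = b.eval 4 n mem p) :=
  ((decides_le a b).and fun _ => decides_le b a).congr le_antisymm_iff.symm

theorem eval_add {a b : Expr} (h : a.eval 4 n mem p + b.eval 4 n mem p < bound 4 n) :
    (op .add a b).eval 4 n mem p = a.eval 4 n mem p + b.eval 4 n mem p := Nat.mod_eq_of_lt h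

theorem eval_mul {a b : Expr} (h : a.eval 4 n mem p * b.eval 4 n mem p < bound 4 n) :
    (op .mul a b).eval 4 n mem p = a.eval 4 n mem p * b.eval 4 n mem p := Nat.mod_eq_of_lt h

theorem eval_const {k : ℕ} (h : k < 16) : (const k).eval 4 n mem p = k := by
  refine Nat.mod_eq_of_lt (h.trans_le ?_)
  calc 16 = 2 ^ 4 := by norm_num
    _ ≤ (n + 2) ^ 4 := Nat.pow_le_pow_left (by omega) 4

/-- The square covers the addresses of the multiplication table; the generous multiple of `n` covers
small sums and the loop counter, which stays below `2 * n`. -/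
theorem sq_le_bound : 8 * n + (n + 2) ^ 2 ≤ bound 4 n := by
  unfold bound
  nlinarith [sq_nonneg ((n + 2) ^ 2), Nat.zero_le n, Nat.zero_le (n ^ 2), Nat.zero_le (n ^ 3)]

theorem eval_size : size.eval 4 n mem p = n := by
  have := sq_le_bound (n := n)
  exact Nat.mod_eq_of_lt (by nlinarith)

/-- The base `n + 2` -/
def base : Expr := op .add size (const 2)

theorem eval_base : base.eval 4 n mem p = n + 2 := by
  have := sq_le_bound (n := n)
  rw [base, eval_add, eval_size, eval_const (by norm_num)]
  rw [eval_size, eval_const (by norm_num)]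
  nlinarith

/-- The processor index divided by `(n + 2) ^ k` -/
def quot : ℕ → Expr
  | 0 => pid
  | k + 1 => op .div (quot k) base

theorem eval_quot (hp : p < bound 4 n) (k : ℕ) :
    (quot k).eval 4 n mem p = p / (n + 2) ^ k := by
  induction k with
  | zero => simpa [quot, eval] using Nat.mod_eq_of_lt hp
  | succ k ih =>
    have : (quot (k + 1)).eval 4 n mem p = (quot k).eval 4 n mem p / base.eval 4 n mem p :=
      Nat.mod_eq_of_lt ((Nat.div_le_self _ _).trans_lt (eval_lt _))
    rw [this, ih, eval_base, Nat.div_div_eq_div_mul, pow_succ]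

/-- The `k`-th digit of the processor index in base `n + 2` -/
def digit (k : ℕ) : Expr := op .mod (quot k) base

end Expr

/-! ### Digits of the processor index and array addresses -/

/-- The `k`-th digit of `p` in base `n + 2` -/
def digit (n k p : ℕ) : ℕ := p / (n + 2) ^ k % (n + 2)

theorem digit_lt {k : ℕ} : digit n k p < n + 2 := Nat.mod_lt _ (by omega)

theorem exists_digit {i j u v : ℕ} (hi : i < n + 2) (hj : j < n + 2) (hu : u < n + 2)
    (hv : v < n + 2) :
    ∃ p < bound 4 n, digit n 3 p = i ∧ digit n 2 p = j ∧ digit n 1 p = u ∧ digit n 0 p = v := by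
  have step : ∀ q d, d < n + 2 → (q * (n + 2) + d) / (n + 2) = q ∧
      (q * (n + 2) + d) % (n + 2) = d := by
    intro q d hd
    rw [mul_comm, Nat.mul_add_div (by omega), Nat.mul_add_mod, Nat.div_eq_of_lt hd,
      Nat.mod_eq_of_lt hd]
    simp
  refine ⟨((i * (n + 2) + j) * (n + 2) + u) * (n + 2) + v, ?_, ?_, ?_, ?_, ?_⟩
  · have h1 : i * (n + 2) + j < (n + 2) ^ 2 := by nlinarith
    have h2 : (i * (n + 2) + j) * (n + 2) + u < (n + 2) ^ 3 := by
      nlinarith [pow_succ (n + 2) 2]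
    unfold bound
    nlinarith [pow_succ (n + 2) 3]
  · rw [digit, pow_succ, pow_two, ← Nat.div_div_eq_div_mul, ← Nat.div_div_eq_div_mul,
      (step _ v hv).1, (step _ u hu).1, (step _ j hj).1, Nat.mod_eq_of_lt hi]
  · rw [digit, pow_two, ← Nat.div_div_eq_div_mul, (step _ v hv).1, (step _ u hu).1,
      (step _ j hj).2]
  · rw [digit, pow_one, (step _ v hv).1, (step _ u hu).2]
  · rw [digit, pow_zero, Nat.div_one, (step _ v hv).2]

/-- The address of entry `(i, j, u)` of a three-dimensional array -/
def cell (n i j u : ℕ) : ℕ := ((n + 2 + i) * (n + 2) + j) * (n + 2) + u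

/-- The leading coefficient `n + 2 + i` places the array above the multiplication table and the
input vector, so writing to the array never damages them. -/
theorem cell_ge {i j u : ℕ} : (n + 2) ^ 3 ≤ cell n i j u := by
  unfold cell
  nlinarith [Nat.zero_le (i * (n + 2)), Nat.zero_le (i * (n + 2) * (n + 2)),
    Nat.zero_le (j * (n + 2))]

theorem cell_bounds {i j u : ℕ} (hi : i < n + 2) (hj : j < n + 2) (hu : u < n + 2) :
    (n + 2 + i) * (n + 2) + j < bound 4 n ∧ cell n i j u < bound 4 n := by
  have h1 : (n + 2 + i) * (n + 2) + j < 2 * (n + 2) ^ 2 := by nlinarith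
  have h2 : cell n i j u < 2 * (n + 2) ^ 3 := by
    unfold cell
    nlinarith [pow_succ (n + 2) 2]
  have h3 : 2 * (n + 2) ^ 3 ≤ bound 4 n := by
    unfold bound
    nlinarith [pow_succ (n + 2) 3, Nat.zero_le (n * (n + 2) ^ 3)]
  have h4 : (n + 2 + i) * (n + 2) + j ≤ cell n i j u := by
    unfold cell
    nlinarith [Nat.zero_le (((n + 2 + i) * (n + 2) + j) * n)]
  omega

theorem cell_inj {i j u i' j' u' : ℕ} (hj : j < n + 2) (hu : u < n + 2) (hj' : j' < n + 2)
    (hu' : u' < n + 2) (h : cell n i j u = cell n i' j' u') : i = i' ∧ j = j' ∧ u = u' := by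
  have key : ∀ a b c d : ℕ, b < n + 2 → d < n + 2 → a * (n + 2) + b = c * (n + 2) + d →
      a = c ∧ b = d := by
    intro a b c d hb hd h
    have hmod := congrArg (· % (n + 2)) h
    have hdiv := congrArg (· / (n + 2)) h
    simp only [mul_comm _ (n + 2), Nat.mul_add_mod, Nat.mod_eq_of_lt hb, Nat.mod_eq_of_lt hd,
      Nat.mul_add_div (show 0 < n + 2 by omega), Nat.div_eq_of_lt hb, Nat.div_eq_of_lt hd] at hmod hdiv
    omega
  obtain ⟨h1, h2⟩ := key _ _ _ _ hu hu' h
  obtain ⟨h3, h4⟩ := key _ _ _ _ hj hj' h1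
  omega

namespace Expr

theorem eval_digit (hp : p < bound 4 n) (k : ℕ) :
    (Expr.digit k).eval 4 n mem p = PRAM.digit n k p := by
  have : (Expr.digit k).eval 4 n mem p = (quot k).eval 4 n mem p % base.eval 4 n mem p :=
    Nat.mod_eq_of_lt ((Nat.mod_le _ _).trans_lt (eval_lt _))
  rw [this, eval_quot hp, eval_base]
  rfl

/-- The address of an array entry -/
def cell (i j u : Expr) : Expr :=
  op .add (op .mul (op .add (op .mul (op .add base i) base) j) base) u

theorem eval_cell {i j u : Expr} (hi : i.eval 4 n mem p < n + 2) (hj : j.eval 4 n mem p < n + 2)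
    (hu : u.eval 4 n mem p < n + 2) : (cell i j u).eval 4 n mem p =
      PRAM.cell n (i.eval 4 n mem p) (j.eval 4 n mem p) (u.eval 4 n mem p) := by
  obtain ⟨h1, h2⟩ := cell_bounds hi hj hu
  have h0 : n + 2 + i.eval 4 n mem p ≤ (n + 2 + i.eval 4 n mem p) * (n + 2) :=
    Nat.le_mul_of_pos_right _ (by omega)
  have e1 : (op .add base i).eval 4 n mem p = n + 2 + i.eval 4 n mem p := by
    rw [eval_add, eval_base]
    rw [eval_base]; omega
  have e2 : (op .mul (op .add base i) base).eval 4 n mem p =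
      (n + 2 + i.eval 4 n mem p) * (n + 2) := by
    rw [eval_mul, e1, eval_base]
    rw [e1, eval_base]; omega
  have e3 : (op .add (op .mul (op .add base i) base) j).eval 4 n mem p =
      (n + 2 + i.eval 4 n mem p) * (n + 2) + j.eval 4 n mem p := by
    rw [eval_add, e2]
    rw [e2]; omega
  unfold PRAM.cell at h2 ⊢
  have e4 : (op .mul (op .add (op .mul (op .add base i) base) j) base).eval 4 n mem p =
      ((n + 2 + i.eval 4 n mem p) * (n + 2) + j.eval 4 n mem p) * (n + 2) := by
    rw [eval_mul, e3, eval_base]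
    rw [e3, eval_base]; omega
  rw [cell, eval_add, e4]
  rw [e4]; omega

theorem eval_load {a : Expr} (h : mem (a.eval 4 n mem p) < bound 4 n) :
    (load a).eval 4 n mem p = mem (a.eval 4 n mem p) := Nat.mod_eq_of_lt h

/-- The address `a` if `g` is true, and the address `1` otherwise -/
def guard (g a : Expr) : Expr :=
  op .add (op .mul g (op .sub a (const 1))) (const 1)

/-- Conditional stores are done without branching: the address is `g * (a - 1) + 1`, so inactive
processors write to cell `1`. That cell serves as a dump, since it matters only as the answer of a
query, which overwrites it. -/
theorem eval_guard_of_true {g a : Expr} (hg : g.eval 4 n mem p = 1) (ha : 1 ≤ a.eval 4 n mem p) :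
    (guard g a).eval 4 n mem p = a.eval 4 n mem p := by
  have := eval_lt a (n := n) (mem := mem) (p := p)
  simp only [guard, eval, BinOp.eval, hg, one_mul]
  rw [Nat.mod_eq_of_lt one_lt_bound, Nat.mod_mod, Nat.mod_eq_of_lt (a := _ - 1) (by omega),
    Nat.mod_eq_of_lt (by omega)]
  omega

theorem eval_guard_of_false {g a : Expr} (hg : g.eval 4 n mem p = 0) :
    (guard g a).eval 4 n mem p = 1 := by
  simp only [guard, eval, BinOp.eval, hg, zero_mul]
  rw [Nat.mod_eq_of_lt one_lt_bound, Nat.zero_mod, zero_add, Nat.mod_eq_of_lt one_lt_bound]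

end Expr

/-! ### Guarded parallel stores -/

open Classical in
/-- The effect of storing the constant `b` in all array entries
`(digit n 3 p, digit n 2 p, f (digit n 1 p) (digit n 0 p))` for which `G` holds, in terms of the
digits of the processor index `p`. -/
theorem storeEffect_guard {g t : Expr} {b : ℕ} (hb : b < 16) {G : ℕ → ℕ → ℕ → ℕ → Prop}
    {f : ℕ → ℕ → ℕ}
    (hg : ∀ p < bound 4 n, g.Decides n mem p
      (G (digit n 3 p) (digit n 2 p) (digit n 1 p) (digit n 0 p)))
    (hf : ∀ i j u v, G i j u v → f u v < n + 2)
    (ht : ∀ p < bound 4 n, G (digit n 3 p) (digit n 2 p) (digit n 1 p) (digit n 0 p) →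
      t.eval 4 n mem p = f (digit n 1 p) (digit n 0 p)) :
    (∀ x < (n + 2) ^ 3, x ≠ 1 → storeEffect 4 n (.guard g (.cell (.digit 3) (.digit 2) t))
      (.const b) mem x = mem x) ∧
    ∀ i < n + 2, ∀ j < n + 2, ∀ w < n + 2,
      storeEffect 4 n (.guard g (.cell (.digit 3) (.digit 2) t)) (.const b) mem (cell n i j w) =
        if ∃ u < n + 2, ∃ v < n + 2, G i j u v ∧ f u v = w then b else mem (cell n i j w) := by
  -- Away from the dump cell `1`, a processor hits `x` only if its guard holds and `x` is its array
  -- entry.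
  have haddr : ∀ p < bound 4 n, ∀ x ≠ 1,
      ((Expr.guard g (.cell (.digit 3) (.digit 2) t)).eval 4 n mem p = x ↔
        G (digit n 3 p) (digit n 2 p) (digit n 1 p) (digit n 0 p) ∧
          cell n (digit n 3 p) (digit n 2 p) (f (digit n 1 p) (digit n 0 p)) = x) := by
    intro p hp x hx
    by_cases hG : G (digit n 3 p) (digit n 2 p) (digit n 1 p) (digit n 0 p)
    · have ec : (Expr.cell (.digit 3) (.digit 2) t).eval 4 n mem p =
          cell n (digit n 3 p) (digit n 2 p) (f (digit n 1 p) (digit n 0 p)) := by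
        rw [Expr.eval_cell, Expr.eval_digit hp, Expr.eval_digit hp, ht p hp hG]
        · rw [Expr.eval_digit hp]; exact digit_lt
        · rw [Expr.eval_digit hp]; exact digit_lt
        · rw [ht p hp hG]; exact hf _ _ _ _ hG
      rw [Expr.eval_guard_of_true ((hg p hp).1 hG), ec]
      · simp [hG]
      · rw [ec]
        exact (Nat.one_le_pow _ _ (by omega)).trans cell_ge
    · rw [Expr.eval_guard_of_false ((hg p hp).2 hG)]
      simp [hG, hx.symm]
  refine ⟨fun x hx hx1 => ?_, fun i hi j hj w hw => ?_⟩
  · rw [storeEffect_of_forall_eq (fun _ => Expr.eval_const hb), if_neg]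
    rintro ⟨p, hp, h⟩
    rw [haddr p hp x hx1] at h
    exact absurd (cell_ge.trans h.2.le) (not_le.2 hx)
  · rw [storeEffect_of_forall_eq (fun _ => Expr.eval_const hb)]
    have h1 : cell n i j w ≠ 1 := by
      have := (Nat.pow_le_pow_left (show 2 ≤ n + 2 by omega) 3).trans
        (cell_ge (n := n) (i := i) (j := j) (u := w))
      omega
    congr 1
    refine propext ⟨?_, ?_⟩
    · rintro ⟨p, hp, h⟩
      rw [haddr p hp _ h1] at h
      obtain ⟨rfl, rfl, rfl⟩ := cell_inj digit_lt (hf _ _ _ _ h.1) hj hw h.2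
      exact ⟨_, digit_lt, _, digit_lt, h.1, rfl⟩
    · rintro ⟨u, hu, v, hv, hG, rfl⟩
      obtain ⟨p, hp, rfl, rfl, rfl, rfl⟩ := exists_digit hi hj hu hv
      exact ⟨p, hp, (haddr p hp _ h1).2 ⟨hG, rfl⟩⟩

end Expressions

end PRAM

namespace DynMembership

open PRAM

set_option linter.unusedSectionVars false

variable {M : Type*} [CommMonoid M] {n : ℕ} {e : M ≃ Fin n} {mem : ℕ → ℕ} {p : ℕ}

/-! ### Families of subsets of `M` in the shared memory -/

/-- The element with number `u`, or `1` if there is none -/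
def elt (e : M ≃ Fin n) (u : ℕ) : M := if h : u < n then e.symm ⟨u, h⟩ else 1

@[simp]
theorem elt_apply (a : M) : elt e (e a) = a := by simp [elt]

theorem apply_elt {u : ℕ} (h : u < n) : (e (elt e u) : ℕ) = u := by simp [elt, h]

/-- The shared memory `mem` contains the multiplication table of `M`. -/
def IsTable (e : M ≃ Fin n) (mem : ℕ → ℕ) : Prop :=
  ∀ a b : M, mem (2 + n * e a + e b) = e (a * b)

open Classical in
/-- The shared memory `mem` contains the characteristic vectors of the sets `F i j`. -/
def Holds (e : M ≃ Fin n) (mem : ℕ → ℕ) (F : ℕ → ℕ → Set M) : Prop :=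
  ∀ i < n + 2, ∀ j < n + 2, ∀ m, mem (cell n i j (e m)) = if m ∈ F i j then 1 else 0

theorem table_address_lt (a b : M) : 2 + n * e a + e b < (n + 2) ^ 2 := by
  nlinarith [(e a).2, (e b).2]

theorem sq_le_cube : (n + 2) ^ 2 ≤ (n + 2) ^ 3 := Nat.pow_le_pow_right (by omega) (by norm_num)

theorem IsTable.congr {mem' : ℕ → ℕ} (h : IsTable e mem)
    (hm : ∀ x < (n + 2) ^ 3, 2 ≤ x → mem' x = mem x) : IsTable e mem' := by
  intro a b
  rw [hm _ ((table_address_lt a b).trans_le sq_le_cube) (by omega), h]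

theorem Holds.congr {mem' : ℕ → ℕ} {F : ℕ → ℕ → Set M} (h : Holds e mem F)
    (hm : ∀ x, 2 ≤ x → mem' x = mem x) : Holds e mem' F := by
  intro i hi j hj m
  rw [hm, h i hi j hj m]
  exact ((Nat.le_self_pow (by norm_num) _).trans' (by omega)).trans (cell_ge (n := n))

theorem Holds.of_eq {F F' : ℕ → ℕ → Set M} (h : Holds e mem F)
    (hF : ∀ i < n + 2, ∀ j < n + 2, F i j = F' i j) : Holds e mem F' := by
  intro i hi j hj m
  rw [h i hi j hj m, hF i hi j hj]

/-- The entry of the multiplication table -/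
def tableEntry (u v : Expr) : Expr :=
  .load (.op .add (.op .add (.const 2) (.op .mul .size u)) v)

theorem eval_tableEntry {u v : Expr} {a b : M} (h : IsTable e mem)
    (hu : u.eval 4 n mem p = e a) (hv : v.eval 4 n mem p = e b) :
    (tableEntry u v).eval 4 n mem p = e (a * b) := by
  have hlt := table_address_lt (e := e) a b
  have hB := Expr.sq_le_bound (n := n)
  have h1 : (Expr.op .mul .size u).eval 4 n mem p = n * e a := by
    rw [Expr.eval_mul, Expr.eval_size, hu]
    rw [Expr.eval_size, hu]; omega
  have h2 : (Expr.op .add (.const 2) (.op .mul .size u)).eval 4 n mem p = 2 + n * e a := by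
    rw [Expr.eval_add, Expr.eval_const (by norm_num), h1]
    rw [Expr.eval_const (by norm_num), h1]; omega
  have h3 : (Expr.op .add (.op .add (.const 2) (.op .mul .size u)) v).eval 4 n mem p =
      2 + n * e a + e b := by
    rw [Expr.eval_add, h2, hv]
    rw [h2, hv]; omega
  rw [tableEntry, Expr.eval_load, h3, h]
  rw [h3, h]
  have := (e (a * b)).2
  nlinarith

/-- The bit that tells membership in `F i j` -/
def entry (i j u : Expr) : Expr := .load (.cell i j u)

theorem decides_entry {F : ℕ → ℕ → Set M} {i j u : Expr} {m : M} (h : Holds e mem F)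
    (hi : i.eval 4 n mem p < n + 2) (hj : j.eval 4 n mem p < n + 2)
    (hu : u.eval 4 n mem p = e m) :
    (entry i j u).Decides n mem p (m ∈ F (i.eval 4 n mem p) (j.eval 4 n mem p)) := by
  classical
  have hc := Expr.eval_cell hi hj (by rw [hu]; have := (e m).2; omega)
  have hB := Expr.one_lt_bound (n := n)
  have hval := h _ hi _ hj m
  have hev : (entry i j u).eval 4 n mem p =
      if m ∈ F (i.eval 4 n mem p) (j.eval 4 n mem p) then 1 else 0 := by
    rw [entry, Expr.eval_load, hc, hu, hval]
    rw [hc, hu, hval]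
    split_ifs <;> omega
  exact ⟨fun hm => by rw [hev, if_pos hm], fun hm => by rw [hev, if_neg hm]⟩

theorem decides_digit_lt (hp : p < bound 4 n) (k : ℕ) :
    (Expr.lt (.digit k) .size).Decides n mem p (digit n k p < n) :=
  (Expr.decides_lt _ _).congr (by rw [Expr.eval_digit hp, Expr.eval_size])

/-- The address at which processor `p` with digits `i, j, u, v` changes the membership of `u` in
`F i j` if `g` holds -/
def elemAddr (g : Expr) : Expr :=
  .guard (.and (.lt (.digit 1) .size) g) (.cell (.digit 3) (.digit 2) (.digit 1))

/-- The address at which processor `p` with digits `i, j, u, v` changes the membership of `u * v` in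
`F i j` if `g` holds -/
def mulAddr (g : Expr) : Expr :=
  .guard (.and (.lt (.digit 1) .size) (.and (.lt (.digit 0) .size) g))
    (.cell (.digit 3) (.digit 2) (tableEntry (.digit 1) (.digit 0)))

-- The last digit `v` does not enter the address, so concurrent writing by all `v` computes an
-- existential quantifier over `v` in one store.
open Classical in
theorem storeEffect_elemAddr {g : Expr} {b : ℕ} (hb : b < 16) {R : ℕ → ℕ → M → ℕ → Prop}
    (hg : ∀ p < bound 4 n, ∀ a : M, digit n 1 p = e a →
      g.Decides n mem p (R (digit n 3 p) (digit n 2 p) a (digit n 0 p))) :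
    (∀ x < (n + 2) ^ 3, x ≠ 1 → storeEffect 4 n (elemAddr g) (.const b) mem x = mem x) ∧
    ∀ i < n + 2, ∀ j < n + 2, ∀ m : M,
      storeEffect 4 n (elemAddr g) (.const b) mem (cell n i j (e m)) =
        if ∃ v < n + 2, R i j m v then b else mem (cell n i j (e m)) := by
  obtain ⟨h1, h2⟩ := storeEffect_guard (mem := mem) (n := n)
    (g := .and (.lt (.digit 1) .size) g) (t := .digit 1) hb
    (G := fun i j u v => u < n ∧ R i j (elt e u) v) (f := fun u _ => u)
    (fun p hp => (decides_digit_lt hp 1).and fun hu => hg p hp _ (apply_elt hu).symm)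
    (fun i j u v h => by have := h.1; omega) (fun p hp _ => Expr.eval_digit hp 1)
  refine ⟨h1, fun i hi j hj m => ?_⟩
  have hm := (e m).2
  rw [elemAddr, h2 i hi j hj _ (by omega)]
  congr 1
  refine propext ⟨?_, ?_⟩
  · rintro ⟨u, _, v, hv, ⟨_, hR⟩, rfl⟩
    exact ⟨v, hv, by simpa using hR⟩
  · rintro ⟨v, hv, hR⟩
    exact ⟨e m, by omega, v, hv, ⟨hm, by simpa using hR⟩, rfl⟩

theorem Holds.insert_elem {F : ℕ → ℕ → Set M} {g : Expr} {R : ℕ → ℕ → M → ℕ → Prop}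
    (h : Holds e mem F)
    (hg : ∀ p < bound 4 n, ∀ a : M, digit n 1 p = e a →
      g.Decides n mem p (R (digit n 3 p) (digit n 2 p) a (digit n 0 p))) :
    Holds e (storeEffect 4 n (elemAddr g) (.const 1) mem)
      fun i j => F i j ∪ {m | ∃ v < n + 2, R i j m v} := by
  classical
  intro i hi j hj m
  rw [(storeEffect_elemAddr (by norm_num) hg).2 i hi j hj m, h i hi j hj m]
  by_cases h1 : m ∈ F i j <;> by_cases h2 : ∃ v < n + 2, R i j m v <;>
    simp only [h1, h2, if_true, if_false, Set.mem_union, Set.mem_ofPred_eq, or_true, or_false]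

theorem Holds.delete_elem {F : ℕ → ℕ → Set M} {g : Expr} {R : ℕ → ℕ → M → ℕ → Prop}
    (h : Holds e mem F)
    (hg : ∀ p < bound 4 n, ∀ a : M, digit n 1 p = e a →
      g.Decides n mem p (R (digit n 3 p) (digit n 2 p) a (digit n 0 p))) :
    Holds e (storeEffect 4 n (elemAddr g) (.const 0) mem)
      fun i j => F i j \ {m | ∃ v < n + 2, R i j m v} := by
  classical
  intro i hi j hj m
  rw [(storeEffect_elemAddr (by norm_num) hg).2 i hi j hj m, h i hi j hj m]
  by_cases h1 : m ∈ F i j <;> by_cases h2 : ∃ v < n + 2, R i j m v <;>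
    simp only [h1, h2, if_true, if_false, Set.mem_sdiff, Set.mem_ofPred_eq, not_true, not_false_iff,
      and_true, and_false]

/-- The processors for all factorizations of `m` write to the same cell, which gives the disjunction
over them. Guards are evaluated on the memory before the store, so entries read as factors may
themselves be targets. -/
theorem Holds.insert_mul {F : ℕ → ℕ → Set M} {g : Expr} {R : ℕ → ℕ → M → M → Prop}
    (h : Holds e mem F) (ht : IsTable e mem)
    (hg : ∀ p < bound 4 n, ∀ a b : M, digit n 1 p = e a → digit n 0 p = e b →
      g.Decides n mem p (R (digit n 3 p) (digit n 2 p) a b)) :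
    Holds e (storeEffect 4 n (mulAddr g) (.const 1) mem)
      (fun i j => F i j ∪ {m | ∃ a b, R i j a b ∧ a * b = m}) ∧
    ∀ x < (n + 2) ^ 3, x ≠ 1 → storeEffect 4 n (mulAddr g) (.const 1) mem x = mem x := by
  classical
  obtain ⟨h1, h2⟩ := storeEffect_guard (mem := mem) (n := n) (b := 1)
    (g := .and (.lt (.digit 1) .size) (.and (.lt (.digit 0) .size) g))
    (t := tableEntry (.digit 1) (.digit 0)) (by norm_num)
    (G := fun i j u v => u < n ∧ v < n ∧ R i j (elt e u) (elt e v))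
    (f := fun u v => e (elt e u * elt e v))
    (fun p hp => (decides_digit_lt hp 1).and fun hu => (decides_digit_lt hp 0).and fun hv =>
      hg p hp _ _ (apply_elt hu).symm (apply_elt hv).symm)
    (fun i j u v _ => (e _).2.trans (by omega))
    (fun p hp hG => eval_tableEntry ht (by rw [Expr.eval_digit hp, apply_elt hG.1])
      (by rw [Expr.eval_digit hp, apply_elt hG.2.1]))
  refine ⟨fun i hi j hj m => ?_, h1⟩
  have hm := (e m).2
  have key : (∃ u < n + 2, ∃ v < n + 2, (u < n ∧ v < n ∧ R i j (elt e u) (elt e v)) ∧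
      (e (elt e u * elt e v) : ℕ) = e m) ↔ ∃ a b, R i j a b ∧ a * b = m := by
    constructor
    · rintro ⟨u, _, v, _, ⟨_, _, hR⟩, hm⟩
      exact ⟨_, _, hR, e.injective (Fin.ext hm)⟩
    · rintro ⟨a, b, hR, rfl⟩
      have ha := (e a).2
      have hb := (e b).2
      exact ⟨e a, by omega, e b, by omega, by simpa using hR, by simp⟩
  rw [mulAddr, h2 i hi j hj _ (by omega), h i hi j hj m]
  simp only [key]
  by_cases h1 : m ∈ F i j <;> by_cases h2 : ∃ a b, R i j a b ∧ a * b = m <;>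
    simp only [h1, h2, if_true, if_false, Set.mem_union, Set.mem_ofPred_eq, or_true, or_false]

/-! ### Generating sets -/

/-- The generators in `S` with numbers in `[i, j)`; for `i = n + 1`, only the element number `j`,
whether or not it belongs to `S`. -/
def gens (e : M ≃ Fin n) (S : Set M) (i j : ℕ) : Set M :=
  {s | (i ≤ e s ∧ e s < j ∧ s ∈ S) ∨ (i = n + 1 ∧ (e s : ℕ) = j)}

/-- The shared memory contains the multiplication table and the submonoids generated by
`gens e S i j`. -/
structure Represents (e : M ≃ Fin n) (mem : ℕ → ℕ) (S : Set M) : Prop where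
  table : IsTable e mem
  holds : Holds e mem fun i j => (Submonoid.closure (gens e S i j) : Set M)

theorem Represents.update_arg {S : Set M} (h : Represents e mem S) (v : ℕ) :
    Represents e (Function.update mem argCell v) S := by
  have hm : ∀ x, 2 ≤ x → Function.update mem argCell v x = mem x := fun x hx =>
    Function.update_of_ne (by unfold argCell; omega) _ _
  exact ⟨h.table.congr fun x _ => hm x, h.holds.congr hm⟩

theorem gens_zero_size (S : Set M) : gens e S 0 n = S := by
  ext s
  simp [gens]

/-- Row `n + 1` is an empty interval of numbers, so it is free to hold the powers of single
elements, independently of `S`. -/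
theorem gens_succ_size (S : Set M) (a : M) : gens e S (n + 1) (e a) = {a} := by
  ext s
  have := (e s).2
  have h : s = a ↔ (e s : ℕ) = e a := by rw [← Fin.ext_iff, e.injective.eq_iff]
  simp only [gens, Set.mem_ofPred_eq, Set.mem_singleton_iff, h, true_and]
  exact or_iff_right fun h => by omega

theorem gens_insert {S : Set M} {a : M} {i j : ℕ} (hi : i ≤ e a) (hj : e a < j) :
    gens e (S ∪ {a}) i j = gens e S i j ∪ {a} := by
  ext s
  simp only [gens, Set.mem_ofPred_eq, Set.mem_union, Set.mem_singleton_iff]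
  by_cases h : s = a
  · subst h; simp [hi, hj]
  · simp [h]

theorem gens_insert_of_not {S : Set M} {a : M} {i j : ℕ} (h : ¬(i ≤ e a ∧ e a < j)) :
    gens e (S ∪ {a}) i j = gens e S i j := by
  ext s
  simp only [gens, Set.mem_ofPred_eq, Set.mem_union, Set.mem_singleton_iff]
  by_cases hs : s = a
  · subst hs
    tauto
  · simp [hs]

/-- The index `e a + 1` is at most `n`, so the upper part never falls into the special row `n + 1`;
neither does `i`, by `hi`. -/
theorem gens_delete {S : Set M} {a : M} {i j : ℕ} (hi : i ≤ e a) (hj : e a < j) :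
    gens e (S \ {a}) i j = gens e S i (e a) ∪ gens e S (e a + 1) j := by
  ext s
  have h1 := (e s).2
  have h2 := (e a).2
  have h3 : s = a ↔ (e s : ℕ) = e a := by rw [← Fin.ext_iff, e.injective.eq_iff]
  simp only [gens, Set.mem_ofPred_eq, Set.mem_union, Set.mem_sdiff, Set.mem_singleton_iff, h3]
  by_cases hs : s ∈ S <;> simp only [hs, true_and, false_and, and_true, and_false, false_or] <;>
    omega

theorem gens_delete_of_not {S : Set M} {a : M} {i j : ℕ} (h : ¬(i ≤ e a ∧ e a < j)) :
    gens e (S \ {a}) i j = gens e S i j := by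
  ext s
  simp only [gens, Set.mem_ofPred_eq, Set.mem_sdiff, Set.mem_singleton_iff]
  by_cases hs : s = a
  · subst hs
    tauto
  · simp [hs]

/-- Commutativity of `M` enters here: it lets the factors from `A` be collected before those from
`B`. -/
theorem mem_closure_union {A B : Set M} {m : M} :
    m ∈ Submonoid.closure (A ∪ B) ↔
      ∃ a b, (a ∈ Submonoid.closure A ∧ b ∈ Submonoid.closure B) ∧ a * b = m := by
  rw [Submonoid.closure_union, Submonoid.mem_sup]
  constructor
  · rintro ⟨a, ha, b, hb, h⟩
    exact ⟨a, b, ⟨ha, hb⟩, h⟩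
  · rintro ⟨a, b, ⟨ha, hb⟩, h⟩
    exact ⟨a, ha, b, hb, h⟩

/-! ### The programs for requests -/

/-- The argument of the request -/
def arg : Expr := .load (.const 0)

theorem eval_arg {a : M} (h : mem 0 = e a) : arg.eval 4 n mem p = e a := by
  have h0 : (Expr.const 0).eval 4 n mem p = 0 := Expr.eval_const (by norm_num)
  have := Expr.sq_le_bound (n := n)
  have := (e a).2
  rw [arg, Expr.eval_load, h0, h]
  rw [h0, h]
  nlinarith

/-- The successor of `a` -/
def succ (a : Expr) : Expr := .op .add a (.const 1)

theorem eval_succ {a : Expr} (h : a.eval 4 n mem p ≤ n) :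
    (succ a).eval 4 n mem p = a.eval 4 n mem p + 1 := by
  have := Expr.sq_le_bound (n := n)
  rw [succ, Expr.eval_add, Expr.eval_const (by norm_num)]
  rw [Expr.eval_const (by norm_num)]
  nlinarith

/-- The interval of the processor contains the argument. -/
def covers : Expr := .and (.le (.digit 3) arg) (.lt arg (.digit 2))

theorem decides_covers {a : M} (hp : p < bound 4 n) (h : mem 0 = e a) :
    covers.Decides n mem p (digit n 3 p ≤ e a ∧ e a < digit n 2 p) := by
  refine ((Expr.decides_le _ _).and fun _ => Expr.decides_lt _ _).congr ?_
  rw [Expr.eval_digit hp, Expr.eval_digit hp, eval_arg h]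

/-- The program for queries -/
def queryProg : Program := storesCode [(.const 1, entry (.const 0) .size arg)]

/-- The product of the entry `(i, j)` and the powers of the argument, if `[i, j)` contains it -/
def insertAddr : Expr :=
  mulAddr (.and covers (.and (entry (.digit 3) (.digit 2) (.digit 1))
    (entry (succ .size) arg (.digit 0))))

/-- The program for insertions -/
def insertProg : Program := storesCode [(insertAddr, .const 1)]

/-- The product of the entries for the parts of `[i, j)` below and above the argument -/
def splitAddr : Expr :=
  mulAddr (.and covers (.and (entry (.digit 3) arg (.digit 1))
    (entry (succ arg) (.digit 2) (.digit 0))))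

/-- The program for deletions -/
def deleteProg : Program :=
  storesCode [(elemAddr covers, .const 0), (splitAddr, .const 1)]

theorem Represents.query {S : Set M} {m : M} (h : Represents e mem S) (hm : mem 0 = e m)
    {T : ℕ} (hT : queryProg.length ≤ T) :
    ∃ mem', HaltsWithin 4 n queryProg T mem mem' ∧
      (m ∈ Submonoid.closure S → mem' answerCell = 1) ∧
      (m ∉ Submonoid.closure S → mem' answerCell = 0) ∧ Represents e mem' S := by
  classical
  have h0 : ∀ p, (Expr.const 0).eval 4 n mem p = 0 := fun p => Expr.eval_const (by norm_num)
  have h1 : ∀ p, (Expr.const 1).eval 4 n mem p = 1 := fun p => Expr.eval_const (by norm_num)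
  have hd : ∀ p, (entry (.const 0) .size arg).Decides n mem p (m ∈ Submonoid.closure S) := by
    intro p
    have := decides_entry (p := p) (i := .const 0) (j := .size) h.holds (by rw [h0]; omega)
      (by rw [Expr.eval_size]; omega) (eval_arg hm)
    rwa [h0, Expr.eval_size, gens_zero_size] at this
  have hv : ∀ p, (entry (.const 0) .size arg).eval 4 n mem p =
      if m ∈ Submonoid.closure S then 1 else 0 := by
    intro p
    split_ifs with hS
    · exact (hd p).1 hS
    · exact (hd p).2 hS
  have hx := storeEffect_of_forall_eq (a := .const 1) hv
  simp only [h1] at hx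
  have hB : 0 < bound 4 n := zero_lt_one.trans Expr.one_lt_bound
  refine ⟨_, haltsWithin_storesCode hT, fun hS => ?_, fun hS => ?_, ?_⟩
  · exact (hx _).trans (by rw [if_pos ⟨0, hB, rfl⟩, if_pos hS])
  · exact (hx _).trans (by rw [if_pos ⟨0, hB, rfl⟩, if_neg hS])
  · have hm : ∀ x, 2 ≤ x →
        storeEffect 4 n (.const 1) (entry (.const 0) .size arg) mem x = mem x := by
      intro x hx2
      rw [hx, if_neg]
      rintro ⟨_, _, h⟩
      omega
    exact ⟨h.table.congr fun x _ => hm x, h.holds.congr hm⟩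

theorem Represents.insert {S : Set M} {a : M} (h : Represents e mem S) (ha : mem 0 = e a)
    {T : ℕ} (hT : insertProg.length ≤ T) :
    ∃ mem', HaltsWithin 4 n insertProg T mem mem' ∧
      Represents e mem' (S ∪ {a}) := by
  refine ⟨_, haltsWithin_storesCode hT, ?_⟩
  obtain ⟨h1, h2⟩ := h.holds.insert_mul h.table
    (g := .and covers (.and (entry (.digit 3) (.digit 2) (.digit 1))
      (entry (succ .size) arg (.digit 0))))
    (R := fun i j u v => (i ≤ e a ∧ e a < j) ∧ u ∈ Submonoid.closure (gens e S i j) ∧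
      v ∈ Submonoid.closure {a}) (by
      intro p hp u v hu hv
      have hs : (succ .size).eval 4 n mem p = n + 1 := by
        rw [eval_succ] <;> rw [Expr.eval_size]
      have hlt := (e a).2
      refine (decides_covers hp ha).and fun _ => .and ?_ fun _ => ?_
      · have := decides_entry (p := p) (i := .digit 3) (j := .digit 2) (u := .digit 1) (m := u)
          h.holds
          (by rw [Expr.eval_digit hp]; exact digit_lt) (by rw [Expr.eval_digit hp]; exact digit_lt)
          (by rw [Expr.eval_digit hp, hu])
        rwa [Expr.eval_digit hp, Expr.eval_digit hp] at this
      · have := decides_entry (p := p) (i := succ .size) (j := arg) (u := .digit 0) (m := v)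
          h.holds (by rw [hs]; omega) (by rw [eval_arg ha]; omega)
          (by rw [Expr.eval_digit hp, hv])
        rwa [hs, eval_arg ha, gens_succ_size] at this)
  refine ⟨h.table.congr fun x hx hx2 => h2 x hx (by omega), h1.of_eq fun i _ j _ => ?_⟩
  by_cases hij : i ≤ e a ∧ e a < j
  · rw [gens_insert hij.1 hij.2]
    ext m
    simp only [hij, and_self, true_and, ← mem_closure_union, Set.mem_union, Set.mem_ofPred_eq,
      SetLike.mem_coe]
    -- The old entry is not cleared before the store; it is contained in the new one.
    exact or_iff_right_of_imp fun hm => Submonoid.closure_mono Set.subset_union_left hm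
  · rw [gens_insert_of_not hij]
    simp [hij]

/-- Entries covering `a` are first emptied and then refilled. The refill reads only entries for `[i,
a)` and `[a + 1, j)`, which do not cover `a` and have survived the emptying. -/
theorem Represents.delete {S : Set M} {a : M} (h : Represents e mem S) (ha : mem 0 = e a)
    {T : ℕ} (hT : deleteProg.length ≤ T) :
    ∃ mem', HaltsWithin 4 n deleteProg T mem mem' ∧
      Represents e mem' (S \ {a}) := by
  refine ⟨_, haltsWithin_storesCode hT, ?_⟩
  have hcov : ∀ p < bound 4 n, ∀ u : M, digit n 1 p = e u →
      covers.Decides n mem p (digit n 3 p ≤ e a ∧ e a < digit n 2 p) :=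
    fun p hp _ _ => decides_covers hp ha
  have h1 := h.holds.delete_elem (R := fun i j _ _ => i ≤ e a ∧ e a < j) hcov
  have h2 := (storeEffect_elemAddr (b := 0) (by norm_num)
    (R := fun i j _ _ => i ≤ e a ∧ e a < j) hcov).1
  set mem1 := storeEffect 4 n (elemAddr covers) (.const 0) mem
  have ha1 : mem1 0 = e a := by rw [h2 0 (by positivity) (by omega), ha]
  have ht1 : IsTable e mem1 := h.table.congr fun x hx hx2 => h2 x hx (by omega)
  have hlt := (e a).2
  obtain ⟨h3, h4⟩ := h1.insert_mul ht1
    (g := .and covers (.and (entry (.digit 3) arg (.digit 1))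
      (entry (succ arg) (.digit 2) (.digit 0))))
    (R := fun i j u v => (i ≤ e a ∧ e a < j) ∧ u ∈ Submonoid.closure (gens e S i (e a)) ∧
      v ∈ Submonoid.closure (gens e S (e a + 1) j)) (by
      intro p hp u v hu hv
      have hs : (succ arg).eval 4 n mem1 p = e a + 1 := by
        rw [eval_succ] <;> rw [eval_arg ha1]
        exact hlt.le
      refine (decides_covers hp ha1).and fun _ => .and ?_ fun _ => ?_
      · have := decides_entry (p := p) (i := .digit 3) (j := arg) (u := .digit 1) (m := u) h1
          (by rw [Expr.eval_digit hp]; exact digit_lt) (by rw [eval_arg ha1]; omega)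
          (by rw [Expr.eval_digit hp, hu])
        rw [Expr.eval_digit hp, eval_arg ha1] at this
        exact this.congr (by simp)
      · have := decides_entry (p := p) (i := succ arg) (j := .digit 2) (u := .digit 0) (m := v) h1
          (by rw [hs]; omega) (by rw [Expr.eval_digit hp]; exact digit_lt)
          (by rw [Expr.eval_digit hp, hv])
        rw [hs, Expr.eval_digit hp] at this
        exact this.congr (by simp))
  refine ⟨ht1.congr fun x hx hx2 => h4 x hx (by omega), h3.of_eq fun i hi j hj => ?_⟩
  have hv : ∃ v, v < n + 2 := ⟨0, by omega⟩
  by_cases hij : i ≤ e a ∧ e a < j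
  · rw [gens_delete hij.1 hij.2]
    ext m
    simp only [hij, and_self, true_and, ← mem_closure_union, Set.mem_union, Set.mem_ofPred_eq,
      SetLike.mem_coe, and_true, hv, Set.mem_sdiff, not_true, and_false, false_or]
  · rw [gens_delete_of_not hij]
    simp [hij]

theorem Represents.serves {T : ℕ} (hi : insertProg.length ≤ T) (hd : deleteProg.length ≤ T)
    (hq : queryProg.length ≤ T) (rs : List (Request M)) :
    ∀ {mem : ℕ → ℕ} {S : Set M}, Represents e mem S →
      Serves 4 T insertProg deleteProg queryProg e mem S rs := by
  induction rs with
  | nil => intros; trivial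
  | cons r rs ih =>
    intro mem S h
    cases r with
    | insert a =>
      obtain ⟨mem', h1, h2⟩ := (h.update_arg (e a)).insert (Function.update_self _ _ _) hi
      exact ⟨mem', h1, ih h2⟩
    | delete a =>
      obtain ⟨mem', h1, h2⟩ := (h.update_arg (e a)).delete (Function.update_self _ _ _) hd
      exact ⟨mem', h1, ih h2⟩
    | query m =>
      obtain ⟨mem', h1, h2, h3, h4⟩ := (h.update_arg (e m)).query (Function.update_self _ _ _) hq
      exact ⟨mem', h1, h2, h3, ih h4⟩

/-! ### The initialization program -/

/-- In a finite monoid, every element of a submonoid is a product of few generators. -/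
theorem exists_short_list {M : Type*} [Monoid M] [Fintype M] {G : Set M} {m : M}
    (hm : m ∈ Submonoid.closure G) :
    ∃ l : List M, (∀ x ∈ l, x ∈ G) ∧ l.length < Fintype.card M ∧ l.prod = m := by
  classical
  have hex : ∃ k, ∃ l : List M, (∀ x ∈ l, x ∈ G) ∧ l.prod = m ∧ l.length = k := by
    obtain ⟨l, h1, h2⟩ := Submonoid.exists_list_of_mem_closure hm
    exact ⟨_, l, h1, h2, rfl⟩
  obtain ⟨l, h1, h2, h3⟩ := Nat.find_spec hex
  refine ⟨l, h1, ?_, h2⟩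
  by_contra! hlen
  -- A shortest list of length at least the cardinality of `M` has more prefixes than `M` has
  -- elements, so two prefix products agree; cutting out the segment between them gives a shorter
  -- list.
  obtain ⟨a, b, hab, heq⟩ := Fintype.exists_ne_map_eq_of_card_lt
    (fun k : Fin (l.length + 1) => (l.take k).prod) (by rw [Fintype.card_fin]; omega)
  have key : ∀ a b : Fin (l.length + 1), a < b → (l.take a).prod = (l.take b).prod → False := by
    intro a b hab heq
    have hb := b.2
    have hab : (a : ℕ) < b := hab
    refine Nat.find_min hex (m := (l.take a ++ l.drop b).length) ?_
      ⟨l.take a ++ l.drop b, ?_, ?_, rfl⟩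
    · rw [← h3]
      simp only [List.length_append, List.length_take, List.length_drop]
      omega
    · intro x hx
      rcases List.mem_append.1 hx with hx | hx
      · exact h1 x (List.mem_of_mem_take hx)
      · exact h1 x (List.mem_of_mem_drop hx)
    · rw [List.prod_append, heq, ← List.prod_append, List.take_append_drop, h2]
  rcases lt_or_gt_of_ne hab with h | h
  · exact key a b h heq
  · exact key b a h heq.symm

/-- The condition that `u * v ≠ v` -/
def moves : Expr :=
  .and (.lt (.digit 0) .size) (.not (.eq (tableEntry (.digit 1) (.digit 0)) (.digit 0)))

/-- The condition that `u` is a member with number in `[i, j)` of the initial set -/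
def isMember : Expr :=
  .and (.le (.digit 3) (.digit 1)) (.and (.lt (.digit 1) (.digit 2))
    (.load (.op .add (.op .add (.const 2) (.op .mul .size .size)) (.digit 1))))

/-- The condition that `i = n + 1` and `u` has number `j` -/
def isSelf : Expr :=
  .and (.eq (.digit 3) (succ .size)) (.eq (.digit 1) (.digit 2))

/-- The condition that `u` and `v` are in the set with indices `i, j` -/
def bothIn : Expr :=
  .and (entry (.digit 3) (.digit 2) (.digit 1)) (entry (.digit 3) (.digit 2) (.digit 0))

/-- Writes the characteristic vectors of `{1} ∪ gens e S i j` -/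
def initStores : List (Expr × Expr) :=
  [(elemAddr (.const 1), .const 1), (elemAddr moves, .const 0), (elemAddr isMember, .const 1),
    (elemAddr isSelf, .const 1)]

/-- Adds all products of two elements to each set and doubles the counter in cell `0` -/
def roundStores : List (Expr × Expr) :=
  [(mulAddr bothIn, .const 1), (.const 0, succ (.op .add (.load (.const 0)) (.load (.const 0))))]

/-- The body of the initialization loop, with the jump back to its beginning -/
def roundCode : Program :=
  storesCode roundStores ++ jumpCode (.load (.const 0)) .size (storesCode initStores).length

/-- The program for the initialization -/
def initProg : Program := storesCode initStores ++ roundCode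

/-- The number of the identity is not part of the input. It is found as the only element that moves
no `v`, by marking everything and then erasing all elements that move some `v`. -/
theorem decides_moves (hp : p < bound 4 n) (ht : IsTable e mem) {a : M} (ha : digit n 1 p = e a) :
    moves.Decides n mem p (digit n 0 p < n ∧ a * elt e (digit n 0 p) ≠ elt e (digit n 0 p)) := by
  refine (decides_digit_lt hp 0).and fun hv => ?_
  refine (Expr.decides_eq _ _).not.congr (not_congr ?_)
  rw [eval_tableEntry (a := a) (b := elt e (digit n 0 p)) ht (by rw [Expr.eval_digit hp, ha])
    (by rw [Expr.eval_digit hp, apply_elt hv]), Expr.eval_digit hp]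
  nth_rw 2 [← apply_elt (e := e) hv]
  rw [← Fin.ext_iff, e.injective.eq_iff]

theorem decides_isMember {S : Set M} (hp : p < bound 4 n)
    (hS : ∀ s, (s ∈ S → mem (2 + n * n + e s) = 1) ∧ (s ∉ S → mem (2 + n * n + e s) = 0))
    {a : M} (ha : digit n 1 p = e a) :
    isMember.Decides n mem p (digit n 3 p ≤ e a ∧ e a < digit n 2 p ∧ a ∈ S) := by
  have hB := Expr.sq_le_bound (n := n)
  have hlt := (e a).2
  have e1 : (Expr.op .mul .size .size).eval 4 n mem p = n * n := by
    rw [Expr.eval_mul, Expr.eval_size]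
    rw [Expr.eval_size]; nlinarith
  have e2 : (Expr.op .add (.const 2) (.op .mul .size .size)).eval 4 n mem p = 2 + n * n := by
    rw [Expr.eval_add, Expr.eval_const (by norm_num), e1]
    rw [Expr.eval_const (by norm_num), e1]; nlinarith
  have e3 : (Expr.op .add (.op .add (.const 2) (.op .mul .size .size)) (.digit 1)).eval 4 n mem p =
      2 + n * n + e a := by
    rw [Expr.eval_add, e2, Expr.eval_digit hp, ha]
    rw [e2, Expr.eval_digit hp, ha]; nlinarith
  have hB1 := Expr.one_lt_bound (n := n)
  refine ((Expr.decides_le _ _).and fun _ => (Expr.decides_lt _ _).and (Q := a ∈ S) fun _ =>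
    ⟨fun h => ?_, fun h => ?_⟩).congr ?_
  · rw [Expr.eval_load, e3, (hS a).1 h]
    rw [e3, (hS a).1 h]; omega
  · rw [Expr.eval_load, e3, (hS a).2 h]
    rw [e3, (hS a).2 h]; omega
  · rw [Expr.eval_digit hp, Expr.eval_digit hp, Expr.eval_digit hp, ha]

theorem decides_isSelf (hp : p < bound 4 n) {a : M} (ha : digit n 1 p = e a) :
    isSelf.Decides n mem p (digit n 3 p = n + 1 ∧ (e a : ℕ) = digit n 2 p) := by
  refine ((Expr.decides_eq _ _).and fun _ => Expr.decides_eq _ _).congr ?_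
  rw [Expr.eval_digit hp, Expr.eval_digit hp, Expr.eval_digit hp, ha,
    eval_succ (by rw [Expr.eval_size]), Expr.eval_size]

theorem decides_bothIn {F : ℕ → ℕ → Set M} (hp : p < bound 4 n) (h : Holds e mem F) {a b : M}
    (ha : digit n 1 p = e a) (hb : digit n 0 p = e b) :
    bothIn.Decides n mem p
      (a ∈ F (digit n 3 p) (digit n 2 p) ∧ b ∈ F (digit n 3 p) (digit n 2 p)) := by
  have h3 : (Expr.digit 3).eval 4 n mem p = digit n 3 p := Expr.eval_digit hp 3
  have h2 : (Expr.digit 2).eval 4 n mem p = digit n 2 p := Expr.eval_digit hp 2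
  have key : ∀ k (c : M), digit n k p = e c →
      (entry (.digit 3) (.digit 2) (.digit k)).Decides n mem p
        (c ∈ F (digit n 3 p) (digit n 2 p)) := by
    intro k c hc
    rw [← h3, ← h2]
    exact decides_entry h (by rw [h3]; exact digit_lt) (by rw [h2]; exact digit_lt)
      (by rw [Expr.eval_digit hp, hc])
  exact (key 1 a ha).and fun _ => key 0 b hb

/-- The state of the shared memory after `k` rounds of the initialization -/
structure RoundInvariant (e : M ≃ Fin n) (S : Set M) (k : ℕ) (mem : ℕ → ℕ) : Prop where
  -- Cell `0` starts at `0`, so it holds `2 ^ k - 1`; it is free for this use until the first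
  -- request passes its argument there.
  counter : mem 0 + 1 = 2 ^ k
  table : IsTable e mem
  -- The stored sets are only squeezed between the products of at most `2 ^ k` generators and the
  -- full submonoid, which is enough once `n ≤ 2 ^ k`.
  exists_holds : ∃ F : ℕ → ℕ → Set M, Holds e mem F ∧
    (∀ i j, F i j ⊆ Submonoid.closure (gens e S i j)) ∧
    ∀ i j (l : List M), (∀ x ∈ l, x ∈ gens e S i j) → l.length ≤ 2 ^ k → l.prod ∈ F i j

theorem roundInvariant_init (S : Set M) :
    RoundInvariant e S 0 (storesEffect 4 n initStores (inputMemory e S)) := by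
  classical
  have hn : 0 < n := (e 1).pos
  have h64 : 0 < (n + 2) ^ 3 := by positivity
  have hcube : n * n + n + 2 < (n + 2) ^ 3 :=
    lt_of_lt_of_le (by nlinarith) (sq_le_cube (n := n))
  have h0 : inputMemory e S 0 = 0 := by simp [inputMemory]
  have hF0 : Holds e (inputMemory e S) fun _ _ => ∅ := by
    intro i hi j hj m
    have := cell_ge (n := n) (i := i) (j := j) (u := e m)
    simp only [inputMemory, Set.mem_empty_iff_false, if_false]
    rw [if_neg (by omega), dif_neg (by omega), dif_neg (by omega)]
  have ht0 : IsTable e (inputMemory e S) := by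
    intro a b
    have ha : (e a : ℕ) * n + n ≤ n * n := by nlinarith [(e a).2]
    have hlt : 2 + n * e a + e b - 2 < n * n := by
      have := (e b).2
      rw [mul_comm n]; omega
    have hidx : (⟨2 + n * e a + e b - 2, hlt⟩ : Fin (n * n)) = finProdFinEquiv (e a, e b) := by
      ext
      simp only [finProdFinEquiv_apply_val]
      omega
    simp only [inputMemory]
    rw [if_neg (by omega), dif_pos hlt, hidx]
    simp
  have hS0 : ∀ s, (s ∈ S → inputMemory e S (2 + n * n + e s) = 1) ∧
      (s ∉ S → inputMemory e S (2 + n * n + e s) = 0) := by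
    intro s
    have hlt : 2 + n * n + e s - 2 - n * n < n := by
      have := (e s).2
      omega
    have hidx : (⟨2 + n * n + e s - 2 - n * n, hlt⟩ : Fin n) = e s := by
      ext
      show 2 + n * n + e s - 2 - n * n = e s
      omega
    simp only [inputMemory]
    rw [if_neg (by omega), dif_neg (by omega), dif_pos hlt, hidx, Equiv.symm_apply_apply]
    constructor <;> intro h <;> simp [h]
  have hg1 : ∀ p < bound 4 n, ∀ a : M, digit n 1 p = e a →
      (Expr.const 1).Decides n (inputMemory e S) p True :=
    fun _ _ _ _ => ⟨fun _ => Expr.eval_const (by norm_num), fun h => absurd trivial h⟩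
  have hF1 := hF0.insert_elem (R := fun _ _ _ _ => True) hg1
  have hm1 := (storeEffect_elemAddr (b := 1) (by norm_num) (R := fun _ _ _ _ => True) hg1).1
  set mem1 := storeEffect 4 n (elemAddr (.const 1)) (.const 1) (inputMemory e S)
  have ht1 : IsTable e mem1 := ht0.congr fun x hx hx2 => hm1 x hx (by omega)
  have hg2 := fun p (hp : p < bound 4 n) (a : M) => decides_moves (a := a) hp ht1
  have hF2 := hF1.delete_elem
    (R := fun _ _ a v => v < n ∧ a * elt e v ≠ elt e v) hg2
  have hm2 := (storeEffect_elemAddr (b := 0) (by norm_num)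
    (R := fun _ _ a v => v < n ∧ a * elt e v ≠ elt e v) hg2).1
  set mem2 := storeEffect 4 n (elemAddr moves) (.const 0) mem1
  have hS2 : ∀ s, (s ∈ S → mem2 (2 + n * n + e s) = 1) ∧
      (s ∉ S → mem2 (2 + n * n + e s) = 0) := by
    intro s
    have hx : 2 + n * n + e s < (n + 2) ^ 3 := by
      have := (e s).2
      omega
    rw [hm2 _ hx (by omega), hm1 _ hx (by omega)]
    exact hS0 s
  have hg3 := fun p (hp : p < bound 4 n) (a : M) => decides_isMember (a := a) hp hS2
  have hF3 := hF2.insert_elem (R := fun i j a _ => i ≤ e a ∧ e a < j ∧ a ∈ S) hg3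
  have hm3 := (storeEffect_elemAddr (b := 1) (by norm_num)
    (R := fun i j a _ => i ≤ e a ∧ e a < j ∧ a ∈ S) hg3).1
  set mem3 := storeEffect 4 n (elemAddr isMember) (.const 1) mem2
  have hg4 := fun p (hp : p < bound 4 n) (a : M) =>
    decides_isSelf (mem := mem3) (a := a) (e := e) hp
  have hF4 := hF3.insert_elem (R := fun i j a _ => i = n + 1 ∧ (e a : ℕ) = j) hg4
  have hm4 := (storeEffect_elemAddr (b := 1) (by norm_num)
    (R := fun i j a _ => i = n + 1 ∧ (e a : ℕ) = j) hg4).1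
  have hm : ∀ x < (n + 2) ^ 3, x ≠ 1 →
      storesEffect 4 n initStores (inputMemory e S) x = inputMemory e S x := by
    intro x hx hx1
    rw [← hm1 x hx hx1, ← hm2 x hx hx1, ← hm3 x hx hx1, ← hm4 x hx hx1]
    rfl
  refine ⟨by rw [hm 0 h64 (by omega), h0]; rfl, ht0.congr fun x hx hx2 => hm x hx (by omega),
    fun i j => {1} ∪ gens e S i j, hF4.of_eq fun i _ j _ => ?_, fun i j => ?_,
    fun i j l hl hlen => ?_⟩
  · ext m
    have hv : ∃ v, v < n + 2 := ⟨0, by omega⟩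
    -- An element `m ≠ 1` moves the identity, which is the witness `v`.
    have hone : (∃ v < n + 2, v < n ∧ m * elt e v ≠ elt e v) ↔ m ≠ 1 := by
      constructor
      · rintro ⟨v, _, _, h⟩ rfl
        exact h (one_mul _)
      · intro h
        have h1 := (e 1).2
        exact ⟨e 1, by omega, h1, by simpa using h⟩
    simp only [Set.mem_union, Set.mem_sdiff, Set.mem_ofPred_eq, hone, gens,
      Set.mem_singleton_iff, Set.mem_empty_iff_false, and_true, hv, false_or, true_and, not_not,
      ne_eq, or_assoc, exists_and_right]
  · exact Set.union_subset (by simp) Submonoid.subset_closure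
  · match l, hlen with
    | [], _ => simp
    | [x], _ => simpa using Or.inr (hl x (by simp))

theorem RoundInvariant.round {S : Set M} {k : ℕ} (h : RoundInvariant e S k mem)
    (hk : 2 ^ k ≤ n) : RoundInvariant e S (k + 1) (storesEffect 4 n roundStores mem) := by
  classical
  obtain ⟨hc, ht, F, hF, hs, hl⟩ := h
  obtain ⟨h1, h2⟩ := hF.insert_mul ht (R := fun i j a b => a ∈ F i j ∧ b ∈ F i j)
    fun p hp a b ha hb => decides_bothIn hp hF ha hb
  set mem1 := storeEffect 4 n (mulAddr bothIn) (.const 1) mem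
  have h0 : ∀ p, (Expr.const 0).eval 4 n mem1 p = 0 := fun p => Expr.eval_const (by norm_num)
  have hc1 : mem1 0 = mem 0 := h2 0 (by positivity) (by omega)
  have hB := Expr.sq_le_bound (n := n)
  have hB0 : 0 < bound 4 n := zero_lt_one.trans Expr.one_lt_bound
  have hnB : 8 * n < bound 4 n := by nlinarith
  have e1 : ∀ p, (Expr.load (.const 0)).eval 4 n mem1 p = mem 0 := by
    intro p
    rw [Expr.eval_load, h0, hc1]
    rw [h0, hc1]; omega
  have e2 : ∀ p, (Expr.op .add (.load (.const 0)) (.load (.const 0))).eval 4 n mem1 p =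
      mem 0 + mem 0 := by
    intro p
    rw [Expr.eval_add, e1]
    rw [e1]; omega
  have e3 : ∀ p, (succ (.op .add (.load (.const 0)) (.load (.const 0)))).eval 4 n mem1 p =
      mem 0 + mem 0 + 1 := by
    intro p
    rw [succ, Expr.eval_add, e2, Expr.eval_const (by norm_num)]
    rw [e2, Expr.eval_const (by norm_num)]; omega
  have h3 := storeEffect_of_forall_eq (a := .const 0) e3
  simp only [h0] at h3
  have h4 : storesEffect 4 n roundStores mem 0 = mem 0 + mem 0 + 1 :=
    (h3 0).trans (if_pos ⟨0, hB0, rfl⟩)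
  have h5 : ∀ x, 2 ≤ x → storesEffect 4 n roundStores mem x = mem1 x := by
    intro x hx
    refine (h3 x).trans (if_neg ?_)
    rintro ⟨_, _, h⟩
    omega
  refine ⟨by rw [h4, pow_succ, ← hc]; omega, ?_, _, h1.congr h5, fun i j => ?_,
    fun i j l hlg hlen => Or.inr ?_⟩
  · exact ht.congr fun x hx hx2 => by rw [h5 x hx2, h2 x hx (by omega)]
  · refine Set.union_subset (hs i j) ?_
    rintro _ ⟨a, b, ⟨ha, hb⟩, rfl⟩
    exact Submonoid.mul_mem _ (hs i j ha) (hs i j hb)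
  -- A list of length at most `2 ^ (k + 1)` splits into two of length at most `2 ^ k`, the second
  -- possibly empty.
  · refine ⟨(l.take (2 ^ k)).prod, (l.drop (2 ^ k)).prod, ⟨hl i j _ ?_ ?_, hl i j _ ?_ ?_⟩, ?_⟩
    · exact fun x hx => hlg x (List.mem_of_mem_take hx)
    · simp
    · exact fun x hx => hlg x (List.mem_of_mem_drop hx)
    · rw [List.length_drop]
      rw [pow_succ] at hlen
      omega
    · rw [← List.prod_append, List.take_append_drop]

theorem RoundInvariant.represents {S : Set M} {k : ℕ} (h : RoundInvariant e S k mem)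
    (hk : n ≤ 2 ^ k) : Represents e mem S := by
  obtain ⟨_, ht, F, hF, hs, hl⟩ := h
  refine ⟨ht, hF.of_eq fun i _ j _ => (hs i j).antisymm fun m hm => ?_⟩
  let := Fintype.ofEquiv _ e.symm
  obtain ⟨l, h1, h2, rfl⟩ := exists_short_list hm
  rw [Fintype.card_congr e, Fintype.card_fin] at h2
  exact hl i j l h1 (by omega)

theorem RoundInvariant.sync {S : Set M} {k : ℕ} {C : Config} (h : RoundInvariant e S k mem)
    (hk : 2 ^ k ≤ n) (hC : C.Sync (storesCode initStores).length mem) :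
    ∃ mem', RoundInvariant e S (k + 1) mem' ∧
      ((Config.step 4 n initProg)^[roundCode.length] C).Sync
        (if 2 ^ (k + 1) ≤ n then (storesCode initStores).length else initProg.length) mem' := by
  have h' := h.round hk
  have hcode := (codeAt_self initProg).right (a := storesCode initStores) (b := roundCode)
  rw [Nat.zero_add] at hcode
  have h1 := sync_storesCode (c := 4) (n := n) _ hC hcode.left
  have hB := Expr.sq_le_bound (n := n)
  have hnB : 8 * n < bound 4 n := by nlinarith
  have hc := h'.counter
  have h2 := sync_jumpCode (c := 4) (n := n) (x := storesEffect 4 n roundStores mem 0) (y := n) h1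
    hcode.right
    (fun i => by
      have h0 : (Expr.const 0).eval 4 n (storesEffect 4 n roundStores mem) i = 0 :=
        Expr.eval_const (by norm_num)
      rw [Expr.eval_load, h0]
      rw [h0]
      rw [pow_succ] at hc
      omega)
    (fun i => Expr.eval_size)
  refine ⟨_, h', ?_⟩
  rw [← Function.iterate_add_apply, Nat.add_comm] at h2
  have hlen : roundCode.length = (storesCode roundStores).length +
      (jumpCode (.load (.const 0)) .size (storesCode initStores).length).length :=
    List.length_append
  have hlen' : initProg.length = (storesCode initStores).length + roundCode.length :=
    List.length_append
  rw [hlen', hlen, ← Nat.add_assoc]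
  -- The jump condition compares the counter `2 ^ (k + 1) - 1` with `n`; being less than `n` means
  -- exactly `2 ^ (k + 1) ≤ n`.
  convert h2 using 2
  omega

theorem exists_sync_round (S : Set M) (k : ℕ) (hk : 2 ^ k ≤ n) :
    ∃ mem, RoundInvariant e S k mem ∧
      (run 4 n initProg ((storesCode initStores).length + k * roundCode.length)
        (inputMemory e S)).Sync (storesCode initStores).length mem := by
  induction k with
  | zero =>
    refine ⟨_, roundInvariant_init S, ?_⟩
    have := sync_storesCode (c := 4) (n := n) _ (sync_start (inputMemory e S))
      (codeAt_self initProg).left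
    simpa [run] using this
  | succ k ih =>
    obtain ⟨mem, h1, h2⟩ := ih (le_trans (Nat.pow_le_pow_right (by norm_num) (by omega)) hk)
    obtain ⟨mem', h3, h4⟩ :=
      h1.sync (le_trans (Nat.pow_le_pow_right (by norm_num) (by omega)) hk) h2
    refine ⟨mem', h3, ?_⟩
    rw [if_pos hk, run, ← Function.iterate_add_apply] at h4
    rw [run]
    convert h4 using 2
    ring_nf

/-- Since `2 ^ ⌊log₂ n⌋ ≤ n < 2 ^ (⌊log₂ n⌋ + 1)`, the loop leaves after round `⌊log₂ n⌋ + 1`, just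
when the exponent is large enough for `RoundInvariant.represents`. -/
theorem exists_haltsWithin_init (S : Set M) {T : ℕ} (hT : initProg.length ≤ T) :
    ∃ mem, HaltsWithin 4 n initProg (T * (Nat.log 2 n + 1)) (inputMemory e S) mem ∧
      Represents e mem S := by
  have hn : n ≠ 0 := (e 1).pos.ne'
  obtain ⟨mem, h1, h2⟩ := exists_sync_round (e := e) S (Nat.log 2 n) (Nat.pow_log_le_self 2 hn)
  obtain ⟨mem', h3, h4⟩ := h1.sync (Nat.pow_log_le_self 2 hn) h2
  have hlt : n < 2 ^ (Nat.log 2 n + 1) := Nat.lt_pow_succ_log_self (by norm_num) n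
  refine ⟨mem', ?_, h3.represents hlt.le⟩
  rw [if_neg (by omega), run, ← Function.iterate_add_apply] at h4
  refine haltsWithin_of_sync h4 le_rfl ?_
  have hlen : initProg.length = (storesCode initStores).length + roundCode.length :=
    List.length_append
  rw [hlen] at hT
  nlinarith [Nat.mul_le_mul_right (Nat.log 2 n + 1) hT,
    Nat.zero_le ((storesCode initStores).length * Nat.log 2 n)]

end DynMembership

/-! ### The main theorem -/

theorem theorem4 :
    ∃ (c T : ℕ) (init ins del qry : PRAM.Program),
      ∀ (n : ℕ) (M : Type*) [CommMonoid M] (e : M ≃ Fin n) (S : Set M),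
        ∃ mem : ℕ → ℕ,
          PRAM.HaltsWithin c n init (T * (Nat.log 2 n + 1))
            (DynMembership.inputMemory e S) mem ∧
          ∀ rs : List (DynMembership.Request M),
            DynMembership.Serves c T ins del qry e mem S rs := by
  open DynMembership in
  refine ⟨4, initProg.length + insertProg.length + deleteProg.length + queryProg.length,
    initProg, insertProg, deleteProg, queryProg, fun n M _ e S => ?_⟩
  obtain ⟨mem, h1, h2⟩ := DynMembership.exists_haltsWithin_init (e := e) S
    (T := DynMembership.initProg.length + DynMembership.insertProg.length +
      DynMembership.deleteProg.length + DynMembership.queryProg.length) (by omega)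
  exact ⟨mem, h1, fun rs => h2.serves (by omega) (by omega) (by omega) rs⟩
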